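/- Let $\Omega\subset\mathbb R^3$ be a bounded domain with boundary of class $C^{1,\alpha}$, filled with an elastic material of constant density $\rho>0$ and stored energy $W=W(F)$, a $C^2$ function of the $3\times3$ matrices $F$ with $\det F>0$. Write $W'(F)$ for the matrix with entries $\partial W/\partial F^{a}{}_{i}$ ($a$ the row, $i$ the column), and $({\rm Div}\,W'(D\eta))^a=\partial_{x^i}\big(\tfrac{\partial W}{\partial(\partial_i\eta^a)}(D\eta)\big)$. Let $I\subset\mathbb R$ be a nontrivial interval and let $\eta\in C^2(I;C^2(\overline\Omega;\mathbb R^3))$ be a curve of embeddings $\eta(t)$ of $\overline\Omega$ with $\det D\eta(t)>0$. Let $N$ and $\nu$ be the outward unit normals of $\partial\Omega$ and $\partial(\eta(t)(\Omega))$, and let $J^b(\eta)$ be the Jacobian determinant of $\eta(t)$ restricted to $\partial\Omega$. For an operator $F$ put $F_\eta u=(F(u\circ\eta^{-1}))\circ\eta$; this defines $\nabla_\eta,\ {\rm div}_\eta,\ D_\eta,\ \Delta_\eta$. Let $p(t)$ be a real function, $C^1$ on $\eta(t)(\Omega)$ and continuous on $\eta(t)(\overline\Omega)$, and let $q=p\circ\eta$.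 The equations of motion of the incompressible body are $$\det D\eta=1,\qquad \rho\ddot\eta-{\rm Div}\,W'(D\eta)=(\nabla p)\circ\eta\ \text{ in }\Omega,\qquad W'(D\eta)N+(p\circ\eta)\,J^b(\eta)\,\nu\circ\eta=0\ \text{ on }\partial\Omega. \tag{1}$$ (i) If $(\eta,p)$ satisfies (1), then ${\rm div}_\eta\dot\eta=0$ in $\Omega$; on $\partial\Omega$ the vector $W'(D\eta)N$ is perpendicular to $\partial_T\eta=D\eta\,T$ for every $T$ tangent to $\partial\Omega$; and $$\frac{d}{dt}\begin{pmatrix}\eta\\ \rho\dot\eta\end{pmatrix}=\begin{pmatrix}\dot\eta\\ {\rm Div}\,W'(D\eta)+\nabla_\eta q\end{pmatrix}\quad\text{in }\Omega, \tag{2}$$ where $q$ solves $$\Delta_\eta q=-{\rm div}_\eta{\rm Div}\,W'(D\eta)+\rho\,{\rm trace}(D_\eta\dot\eta)^2\ \text{ in }\Omega,\qquad q|_{\partial\Omega}=-\frac{\langle W'(D\eta)N,\nu\circ\eta\rangle}{J^b(\eta)}, \tag{3}$$ the first equation being understood in the sense of distributions (that is, as an equation for $p=q\circ\eta^{-1}$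 on $\eta(t)(\Omega)$). (ii) Conversely, if (2) and (3) hold, $W'(D\eta)N$ is perpendicular to $D\eta\,T$ for all $T$ tangent to $\partial\Omega$, and $\det D\eta=1$ and ${\rm div}_\eta\dot\eta=0$ in $\Omega$ at one time $t_0\in I$, then $(\eta,p)$ satisfies (1). (iii) If $W$ is $C^3$ and, at some $t\in I$, $\eta(t)$ is $C^3$ in $\Omega$, then for this $t$: under (1) the function $p(t)$ is $C^2$ on $\eta(t)(\Omega)$; and whenever $p(t)$ is $C^2$ on $\eta(t)(\Omega)$, the distributional equation in (3) is equivalent to the pointwise one. -/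

import Mathlib

open Set Filter Topology MeasureTheory
open scoped NNReal ContDiff

/-- Euclidean three-space. -/
abbrev E3 : Type := EuclideanSpace ℝ (Fin 3)

namespace ElasticBody

noncomputable section

/-! ### Domains and their normals -/

/-- The boundary of `Ω` is of class `C^{1,α}`: near each boundary point, `Ω` is the negativity set of a
function of class `C^{1,α}` with non-vanishing differential. -/
def HasC1HolderBoundary (α : ℝ≥0) (Ω : Set E3) : Prop :=
  ∀ x ∈ frontier Ω, ∃ φ : E3 → ℝ, ∃ U : Set E3, IsOpen U ∧ x ∈ U ∧
    ContDiffOn ℝ 1 φ U ∧ (∃ C : ℝ≥0, HolderOnWith C α (fderiv ℝ φ) U) ∧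
    (∀ y ∈ U, fderiv ℝ φ y ≠ 0) ∧ ∀ y ∈ U, (y ∈ Ω ↔ φ y < 0)

/-- `n` is the outward unit normal at the boundary point `x` of the open set `S`: near `x` the set
`S` is the negativity set of a `C¹` function which vanishes at `x` and whose gradient at `x` is a
positive multiple of the unit vector `n`. -/
def IsOutwardUnitNormal (S : Set E3) (x n : E3) : Prop :=
  ‖n‖ = 1 ∧ ∃ φ : E3 → ℝ, ContDiffAt ℝ 1 φ x ∧ φ x = 0 ∧
    (∃ c : ℝ, 0 < c ∧ gradient φ x = c • n) ∧ ∀ᶠ y in 𝓝 x, (y ∈ S ↔ φ y < 0)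

/-! ### Deformations -/

/-- The deformation gradient `Dη(x)` of a map of the closed body, at interior and boundary points. -/
def defGrad (Ω : Set E3) (f : E3 → E3) (x : E3) : E3 →L[ℝ] E3 :=
  fderivWithin ℝ f (closure Ω) x

/-- An (orientation preserving) embedding of the closed body. -/
structure IsEmbeddingOfBody (Ω : Set E3) (f : E3 → E3) : Prop where
  contDiffOn : ContDiffOn ℝ 1 f (closure Ω)
  injOn : InjOn f (closure Ω)
  det_pos : ∀ x ∈ closure Ω, 0 < (defGrad Ω f x).det

/-- The velocity `∂ₜη` of a curve of maps, with one-sided derivatives at end points of `I`. -/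
def velocity (I : Set ℝ) (η : ℝ → E3 → E3) (t : ℝ) (x : E3) : E3 :=
  derivWithin (fun s => η s x) I t

/-- The acceleration `∂ₜ²η`. -/
def acceleration (I : Set ℝ) (η : ℝ → E3 → E3) : ℝ → E3 → E3 :=
  velocity I (velocity I η)

/-- Convergence in `C^k(K)`: uniform convergence on `K` of all derivatives of order at most `k`. -/
def TendstoInCk (k : ℕ) (K : Set E3) (f : ℝ → E3 → E3) (l : Filter ℝ) (g : E3 → E3) : Prop :=
  ∀ j ≤ k, TendstoUniformlyOn (fun s => iteratedFDerivWithin ℝ j (f s) K)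
    (iteratedFDerivWithin ℝ j g K) l K

/-- `η` belongs to `C²(I; C^k(K))`. -/
structure IsC2CurveInCk (k : ℕ) (I : Set ℝ) (K : Set E3) (η : ℝ → E3 → E3) : Prop where
  position_mem : ∀ t ∈ I, ContDiffOn ℝ k (η t) K
  velocity_mem : ∀ t ∈ I, ContDiffOn ℝ k (velocity I η t) K
  acceleration_mem : ∀ t ∈ I, ContDiffOn ℝ k (acceleration I η t) K
  hasDeriv_position : ∀ t ∈ I, TendstoInCk k K (fun s x => (s - t)⁻¹ • (η s x - η t x))
    (𝓝[I \ {t}] t) (velocity I η t)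
  hasDeriv_velocity : ∀ t ∈ I,
    TendstoInCk k K (fun s x => (s - t)⁻¹ • (velocity I η s x - velocity I η t x))
      (𝓝[I \ {t}] t) (acceleration I η t)
  continuous_acceleration : ∀ t ∈ I,
    TendstoInCk k K (acceleration I η) (𝓝[I] t) (acceleration I η t)

/-- The Jacobian determinant of the restriction of `F` to the plane orthogonal to `n`, that is
`√det(AᵀA)` with `A` the restriction of `F` to that plane. With `F = Dη(x)` and `n` the unit normal
to `∂Ω` at `x`, this is the Jacobian determinant of `η` restricted to the boundary. -/
def boundaryJacobian (F : E3 →L[ℝ] E3) (n : E3) : ℝ :=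
  let A : ((ℝ ∙ n)ᗮ : Submodule ℝ E3) →L[ℝ] E3 := F ∘L ((ℝ ∙ n)ᗮ : Submodule ℝ E3).subtypeL
  Real.sqrt (ContinuousLinearMap.adjoint A ∘L A).det

/-! ### The stored energy -/

/-- The standard basis vector `e_i`. -/
def e (i : Fin 3) : E3 := EuclideanSpace.single i 1

/-- The elementary matrix `v ↦ v^i e_a`, with a one in row `a` and column `i`. -/
def unitMat (a i : Fin 3) : E3 →L[ℝ] E3 :=
  (EuclideanSpace.proj i : E3 →L[ℝ] ℝ).smulRight (e a)

/-- The domain of a stored energy function: deformation gradients with positive determinant. -/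
def posDet : Set (E3 →L[ℝ] E3) := {F | 0 < F.det}

/-- `W'(F)`, the matrix with entry `∂W/∂(∂_i η^a)` at `F` in row `a` and column `i`. -/
def stress (W : (E3 →L[ℝ] E3) → ℝ) (F : E3 →L[ℝ] E3) : E3 →L[ℝ] E3 :=
  ∑ a : Fin 3, ∑ i : Fin 3, (fderiv ℝ W F (unitMat a i)) • unitMat a i

/-- `Div W'(Dη)`, the vector with components `∂_{x^i} (∂W/∂(∂_i η^a) (Dη(x)))`. -/
def DivStress (W : (E3 →L[ℝ] E3) → ℝ) (Ω : Set E3) (f : E3 → E3) (x : E3) : E3 :=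
  ∑ i : Fin 3, fderiv ℝ (fun y => stress W (defGrad Ω f y) (e i)) x (e i)

/-! ### Operators conjugated by the embedding: `F_η u = (F (u ∘ η⁻¹)) ∘ η` -/

/-- `u ∘ η⁻¹`, a field on the deformed body. -/
def spatial {β : Type*} (Ω : Set E3) (f : E3 → E3) (u : E3 → β) (y : E3) : β :=
  u (Function.invFunOn f (closure Ω) y)

/-- `∇_η q`. -/
def gradEta (Ω : Set E3) (f : E3 → E3) (q : E3 → ℝ) (x : E3) : E3 :=
  gradient (spatial Ω f q) (f x)

/-- `D_η V`. -/
def DEta (Ω : Set E3) (f : E3 → E3) (V : E3 → E3) (x : E3) : E3 →L[ℝ] E3 :=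
  fderiv ℝ (spatial Ω f V) (f x)

/-- `div_η V`. -/
def divEta (Ω : Set E3) (f : E3 → E3) (V : E3 → E3) (x : E3) : ℝ :=
  LinearMap.trace ℝ E3 (DEta Ω f V x : E3 →ₗ[ℝ] E3)

/-- `Δ_η q`. -/
def lapEta (Ω : Set E3) (f : E3 → E3) (q : E3 → ℝ) (x : E3) : ℝ :=
  Laplacian.laplacian (spatial Ω f q) (f x)

/-- `trace (D_η V)²`. -/
def traceSq (Ω : Set E3) (f : E3 → E3) (V : E3 → E3) (x : E3) : ℝ :=
  LinearMap.trace ℝ E3 ((DEta Ω f V x ∘L DEta Ω f V x : E3 →L[ℝ] E3) : E3 →ₗ[ℝ] E3)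

/-! ### The equations -/

/-- The equations of motion of an incompressible elastic body with density `ρ` and stored energy
`W`, for the motion `η` and the function `p t` on the deformed body. Here `N` is the unit normal to
`∂Ω` and `ν t` the unit normal to the boundary of the deformed body. -/
structure EquationsOfMotion (Ω : Set E3) (ρ : ℝ) (W : (E3 →L[ℝ] E3) → ℝ) (I : Set ℝ)
    (N : E3 → E3) (ν : ℝ → E3 → E3) (η : ℝ → E3 → E3) (p : ℝ → E3 → ℝ) : Prop where
  incompressible : ∀ t ∈ I, ∀ x ∈ Ω, (defGrad Ω (η t) x).det = 1
  momentum : ∀ t ∈ I, ∀ x ∈ Ω,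
    ρ • acceleration I η t x - DivStress W Ω (η t) x = gradient (p t) (η t x)
  traction : ∀ t ∈ I, ∀ x ∈ frontier Ω,
    stress W (defGrad Ω (η t) x) (N x) +
      (p t (η t x) * boundaryJacobian (defGrad Ω (η t) x) (N x)) • ν t (η t x) = 0

/-- `A(η, η̇) = Div W'(Dη) + ∇_η q`. -/
def forceA (W : (E3 →L[ℝ] E3) → ℝ) (Ω : Set E3) (f : E3 → E3) (q : E3 → ℝ) (x : E3) : E3 :=
  DivStress W Ω f x + gradEta Ω f q x

/-- The first-order system `d/dt (η, ρ η̇) = (η̇, A(η, η̇))`. -/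
def FirstOrderSystem (Ω : Set E3) (ρ : ℝ) (W : (E3 →L[ℝ] E3) → ℝ) (I : Set ℝ)
    (η : ℝ → E3 → E3) (q : ℝ → E3 → ℝ) : Prop :=
  ∀ t ∈ I, ∀ x ∈ Ω,
    HasDerivWithinAt (fun s => (η s x, ρ • velocity I η s x))
      (velocity I η t x, forceA W Ω (η t) (q t) x) I t

/-- `Δ_η q = -div_η Div W'(Dη) + ρ trace (D_η v)²` pointwise in `Ω`, with `η = f` and `η̇ = v`. -/
def PressureEqPointwise (Ω : Set E3) (ρ : ℝ) (W : (E3 →L[ℝ] E3) → ℝ) (f v : E3 → E3)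
    (q : E3 → ℝ) : Prop :=
  ∀ x ∈ Ω, lapEta Ω f q x = -divEta Ω f (DivStress W Ω f) x + ρ * traceSq Ω f v x

/-- `Δ_η q = -div_η Div W'(Dη) + ρ trace (D_η v)²` in the sense of distributions: the equation
`Δ(q ∘ η⁻¹) = -div((Div W'(Dη)) ∘ η⁻¹) + ρ trace (D(v ∘ η⁻¹))²` on the deformed body `η(Ω)`, tested
against smooth functions with compact support. -/
def PressureEqWeak (Ω : Set E3) (ρ : ℝ) (W : (E3 →L[ℝ] E3) → ℝ) (f v : E3 → E3)
    (q : E3 → ℝ) : Prop :=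
  ∀ ψ : E3 → ℝ, ContDiff ℝ ∞ ψ → HasCompactSupport ψ → tsupport ψ ⊆ f '' Ω →
    -∫ y in f '' Ω, inner ℝ (gradient (spatial Ω f q) y) (gradient ψ y) =
      (∫ y in f '' Ω, inner ℝ (spatial Ω f (DivStress W Ω f) y) (gradient ψ y)) +
        ρ * ∫ y in f '' Ω, spatial Ω f (traceSq Ω f v) y * ψ y

/-- The Dirichlet condition `q = -⟨W'(Dη) N, ν ∘ η⟩ / J^b(η)` on `∂Ω`; here `η = f`. -/
def PressureBoundaryCondition (Ω : Set E3) (W : (E3 →L[ℝ] E3) → ℝ) (N ν f : E3 → E3)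
    (q : E3 → ℝ) : Prop :=
  ∀ x ∈ frontier Ω, q x =
    -inner ℝ (stress W (defGrad Ω f x) (N x)) (ν (f x)) / boundaryJacobian (defGrad Ω f x) (N x)

/-- `W'(Dη) N` is perpendicular to `∂_T η = Dη T` for every `T` tangent to `∂Ω`; here `η = f`. -/
def StressNormalPerp (Ω : Set E3) (W : (E3 →L[ℝ] E3) → ℝ) (N f : E3 → E3) : Prop :=
  ∀ x ∈ frontier Ω, ∀ T : E3, inner ℝ T (N x) = 0 →
    inner ℝ (stress W (defGrad Ω f x) (N x)) (defGrad Ω f x T) = 0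

end

end ElasticBody

/-!
The statement rests on three observations about an embedding `η(t)`, whose inverse is as smooth on
the open set `η(t)(Ω)` as `η(t)` is on `Ω`.

*Kinematics.* At a fixed point of `Ω`, Jacobi's formula gives `(det Dη)˙ = det Dη · div_η η̇`, and
differentiating `D_η η̇ = Dη̇ (Dη)⁻¹` once more gives
`(div_η η̇)˙ = div_η η̈ - trace (D_η η̇)²` (`hasDerivWithinAt_det_defGrad`,
`hasDerivWithinAt_divEta_velocity`). Hence `det Dη = 1` at all times forces `div_η η̇ = 0` and
`div_η η̈ = trace (D_η η̇)²`. Conversely, this last identity at all times, together with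
`det Dη = 1` and `div_η η̇ = 0` at one time, forces `det Dη = 1` at all times.

*The pressure equation.* Along the momentum equation, `∇p + (Div W'(Dη)) ∘ η⁻¹ = ρ η̈ ∘ η⁻¹`. The
right-hand side is `C¹` in space, so the distributional divergence of the left-hand side is a
continuous function, although neither term on the left need be differentiable. Integrating by parts
against test functions, the distributional pressure equation says precisely that
`div_η η̈ = trace (D_η η̇)²` (`pressureEqWeak_iff_trace_fderiv`, `pressureEqWeak_iff_divEta`), which
links it to the kinematic part. When both terms on the left are `C¹`, the same computation gives the
pointwise equation; and if `W` and `η(t)` are `C³`, the momentum equation makes `∇p` of class `C¹`.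

*The boundary.* `Dη` maps the tangent plane of `∂Ω` into that of `∂(η(Ω))`, because it maps
directions that enter `Ω` to directions that do not leave `η(Ω)`
(`inner_normal_defGrad_eq_zero`); being invertible, it maps it onto. The traction condition
therefore splits into its tangential part, the orthogonality of `W'(Dη)N` to `Dη T`, and its normal
part, the Dirichlet condition for `q`; the division by `J^b` is legitimate because `J^b > 0`
(`traction_iff`, `boundaryJacobian_pos`).
-/

namespace ElasticBody

/-! ### Integration by parts and test functions -/

section Calculus

theorem trace_eq_sum (L : E3 →L[ℝ] E3) :
    LinearMap.trace ℝ E3 (L : E3 →ₗ[ℝ] E3) = ∑ i : Fin 3, L (e i) i := by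
  rw [LinearMap.trace_eq_sum_inner _ (EuclideanSpace.basisFun (Fin 3) ℝ)]
  simp [e, EuclideanSpace.inner_single_left]

theorem eq_sum_smul_e (v : E3) : v = ∑ i : Fin 3, v i • e i := by
  ext j
  fin_cases j <;> simp [e, Fin.sum_univ_three]

/-- The trace as a continuous linear functional on `E3 →L[ℝ] E3`. -/
noncomputable def traceCLM : (E3 →L[ℝ] E3) →L[ℝ] ℝ :=
  ∑ i : Fin 3, (EuclideanSpace.proj i : E3 →L[ℝ] ℝ) ∘L ContinuousLinearMap.apply ℝ E3 (e i)

theorem traceCLM_apply (L : E3 →L[ℝ] E3) :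
    traceCLM L = LinearMap.trace ℝ E3 (L : E3 →ₗ[ℝ] E3) := by
  simp [traceCLM, trace_eq_sum]

variable {F G H : Type*} [NormedAddCommGroup F] [NormedSpace ℝ F] [NormedAddCommGroup G]
  [NormedSpace ℝ G] [NormedAddCommGroup H] [NormedSpace ℝ H]

theorem integrable_bilinear_of_tsupport_subset {O : Set E3} (hO : IsOpen O) (B : F →L[ℝ] G →L[ℝ] H)
    {h : E3 → F} (hh : ContinuousOn h O) {k : E3 → G} (hk : Continuous k)
    (hkc : HasCompactSupport k) (hkO : tsupport k ⊆ O) :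
    Integrable (fun x => B (h x) (k x)) := by
  have hsub : tsupport (fun x => B (h x) (k x)) ⊆ tsupport k := by
    refine closure_mono fun x hx => ?_
    rw [Function.mem_support] at hx ⊢
    contrapose! hx
    simp [hx]
  have hcont : Continuous fun x => B (h x) (k x) := by
    refine continuous_of_tsupport fun x hx => ?_
    have h1 : ContinuousAt h x := hh.continuousAt (hO.mem_nhds (hkO (hsub hx)))
    exact (B.continuous.continuousAt.comp h1).clm_apply hk.continuousAt
  exact hcont.integrable_of_hasCompactSupport
    (hkc.of_isClosed_subset (isClosed_tsupport _) hsub)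

theorem tsupport_gradient_subset (ψ : E3 → ℝ) : tsupport (gradient ψ) ⊆ tsupport ψ := by
  refine (closure_mono fun x hx => ?_).trans (tsupport_fderiv_subset ℝ)
  rw [Function.mem_support] at hx ⊢
  contrapose! hx
  simp [gradient, hx]

theorem contDiffAt_gradient_iff {n : ℕ∞} {f : E3 → ℝ} {x : E3} :
    ContDiffAt ℝ n (gradient f) x ↔ ContDiffAt ℝ n (fderiv ℝ f) x := by
  constructor
  · intro h
    have := (InnerProductSpace.toDual ℝ E3).contDiff.contDiffAt.comp x h
    refine this.congr_of_eventuallyEq (Eventually.of_forall fun y => ?_)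
    simp [gradient]
  · intro h
    exact (InnerProductSpace.toDual ℝ E3).symm.contDiff.contDiffAt.comp x h

theorem contDiff_gradient {ψ : E3 → ℝ} (hψ : ContDiff ℝ ∞ ψ) : ContDiff ℝ ∞ (gradient ψ) := by
  rw [contDiff_iff_contDiffAt]
  intro x
  rw [contDiffAt_gradient_iff]
  exact (hψ.fderiv_right (m := ∞) (by simp)).contDiffAt

theorem integrable_inner_gradient {O : Set E3} (hO : IsOpen O) {V : E3 → E3}
    (hV : ContinuousOn V O) {ψ : E3 → ℝ} (hψ : ContDiff ℝ ∞ ψ) (hc : HasCompactSupport ψ)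
    (hs : tsupport ψ ⊆ O) : Integrable (fun y => inner ℝ (V y) (gradient ψ y)) :=
  integrable_bilinear_of_tsupport_subset hO (innerSL ℝ) hV (contDiff_gradient hψ).continuous
    (hc.of_isClosed_subset (isClosed_tsupport _) (tsupport_gradient_subset ψ))
    ((tsupport_gradient_subset ψ).trans hs)

theorem integrable_mul_of_tsupport_subset {O : Set E3} (hO : IsOpen O) {h : E3 → ℝ}
    (hh : ContinuousOn h O) {ψ : E3 → ℝ} (hψ : ContDiff ℝ ∞ ψ) (hc : HasCompactSupport ψ)
    (hs : tsupport ψ ⊆ O) : Integrable (fun y => h y * ψ y) :=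
  integrable_bilinear_of_tsupport_subset hO (ContinuousLinearMap.mul ℝ ℝ) hh hψ.continuous hc hs

/-- Integration by parts against a test function: no boundary term, and the vector field needs to be
`C¹` only on the open set that contains the support of the test function. -/
theorem integral_inner_gradient {O : Set E3} (hO : IsOpen O) {V : E3 → E3}
    (hV : ContDiffOn ℝ 1 V O) {ψ : E3 → ℝ} (hψ : ContDiff ℝ ∞ ψ) (hc : HasCompactSupport ψ)
    (hs : tsupport ψ ⊆ O) :
    ∫ y in O, inner ℝ (V y) (gradient ψ y) = -∫ y in O, traceCLM (fderiv ℝ V y) * ψ y := by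
  have hz : ∀ y ∉ O, ψ y = 0 := fun y hy => image_eq_zero_of_notMem_tsupport fun h => hy (hs h)
  have hz' : ∀ y ∉ O, gradient ψ y = 0 := fun y hy =>
    image_eq_zero_of_notMem_tsupport fun h => hy (hs (tsupport_gradient_subset ψ h))
  rw [setIntegral_eq_integral_of_forall_compl_eq_zero (fun y hy => by simp [hz' y hy]),
    setIntegral_eq_integral_of_forall_compl_eq_zero (fun y hy => by simp [hz y hy])]
  have hVc : ContinuousOn V O := hV.continuousOn
  have hdV : ∀ y ∈ O, DifferentiableAt ℝ V y := fun y hy =>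
    (hV.contDiffAt (hO.mem_nhds hy)).differentiableAt one_ne_zero
  have hDc : ContinuousOn (fderiv ℝ V) O := hV.continuousOn_fderiv_of_isOpen hO le_rfl
  have hcoord : ∀ i : Fin 3, ContinuousOn (fun y => V y i) O := fun i =>
    (EuclideanSpace.proj i : E3 →L[ℝ] ℝ).continuous.comp_continuousOn hVc
  have hdcoord : ∀ (i : Fin 3), ∀ y ∈ O, HasFDerivAt (fun y => V y i)
      ((EuclideanSpace.proj i : E3 →L[ℝ] ℝ) ∘L fderiv ℝ V y) y := fun i y hy =>
    (EuclideanSpace.proj i : E3 →L[ℝ] ℝ).hasFDerivAt.comp y (hdV y hy).hasFDerivAt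
  have hDcoord : ∀ i : Fin 3, ContinuousOn (fun y => fderiv ℝ V y (e i) i) O := fun i =>
    (EuclideanSpace.proj i : E3 →L[ℝ] ℝ).continuous.comp_continuousOn
      (hDc.clm_apply continuousOn_const)
  have hdψ : ∀ i : Fin 3, Continuous fun y => fderiv ℝ ψ y (e i) := fun i =>
    (hψ.continuous_fderiv (by simp)).clm_apply continuous_const
  have hdψs : ∀ i : Fin 3, tsupport (fun y => fderiv ℝ ψ y (e i)) ⊆ tsupport ψ := fun i =>
    tsupport_fderiv_apply_subset ℝ _
  have key : ∀ i : Fin 3, ∫ y, V y i * fderiv ℝ ψ y (e i) =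
      -∫ y, fderiv ℝ V y (e i) i * ψ y := by
    intro i
    refine integral_bilinear_hasFDerivAt_right_eq_neg_left_of_integrable
      (B := ContinuousLinearMap.mul ℝ ℝ) (f := fun y => V y i) (g := ψ)
      (f' := fun y => (EuclideanSpace.proj i : E3 →L[ℝ] ℝ) ∘L fderiv ℝ V y)
      (g' := fderiv ℝ ψ) (v := e i) ?_ ?_ ?_ (fun y hy => hdcoord i y (hs hy))
      (fun y _ => (hψ.differentiable (by simp) y).hasFDerivAt)
    · exact integrable_mul_of_tsupport_subset hO (hDcoord i) hψ hc hs
    · exact integrable_bilinear_of_tsupport_subset hO (ContinuousLinearMap.mul ℝ ℝ) (hcoord i)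
        (hdψ i) (hc.of_isClosed_subset (isClosed_tsupport _) (hdψs i)) ((hdψs i).trans hs)
    · exact integrable_mul_of_tsupport_subset hO (hcoord i) hψ hc hs
  have e1 : ∀ y, inner ℝ (V y) (gradient ψ y) = ∑ i : Fin 3, V y i * fderiv ℝ ψ y (e i) := by
    intro y
    rw [inner_gradient_right]
    conv_lhs => rw [eq_sum_smul_e (V y)]
    simp [map_sum]
  have e2 : ∀ y, traceCLM (fderiv ℝ V y) * ψ y = ∑ i : Fin 3, fderiv ℝ V y (e i) i * ψ y := by
    intro y
    rw [traceCLM_apply, trace_eq_sum, Finset.sum_mul]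
  simp_rw [e1, e2]
  rw [integral_finsetSum, integral_finsetSum, ← Finset.sum_neg_distrib]
  · exact Finset.sum_congr rfl fun i _ => key i
  · exact fun i _ => integrable_mul_of_tsupport_subset hO (hDcoord i) hψ hc hs
  · exact fun i _ => integrable_bilinear_of_tsupport_subset hO (ContinuousLinearMap.mul ℝ ℝ)
      (hcoord i) (hdψ i) (hc.of_isClosed_subset (isClosed_tsupport _) (hdψs i)) ((hdψs i).trans hs)

/-- A continuous function on an open set vanishes if and only if it vanishes as a distribution. -/
theorem forall_integral_mul_eq_zero_iff {O : Set E3} (hO : IsOpen O) {h : E3 → ℝ}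
    (hh : ContinuousOn h O) :
    (∀ ψ : E3 → ℝ, ContDiff ℝ ∞ ψ → HasCompactSupport ψ → tsupport ψ ⊆ O →
      ∫ y in O, h y * ψ y = 0) ↔ ∀ y ∈ O, h y = 0 := by
  constructor
  · intro H
    have hae := hO.ae_eq_zero_of_integral_contDiff_smul_eq_zero (μ := volume) (f := h)
      (hh.locallyIntegrableOn hO.measurableSet) fun ψ hψ hc hs => by
        have := H ψ hψ hc hs
        rw [setIntegral_eq_integral_of_forall_compl_eq_zero (fun y hy => by
          simp [image_eq_zero_of_notMem_tsupport fun h => hy (hs h)])] at this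
        simpa [mul_comm] using this
    have : h =ᵐ[volume.restrict O] fun _ => 0 := (ae_restrict_iff' hO.measurableSet).2 hae
    exact Measure.eqOn_open_of_ae_eq this hO hh continuousOn_const
  · intro H ψ _ _ _
    rw [setIntegral_congr_fun hO.measurableSet (g := fun _ => 0) fun y hy => by simp [H y hy]]
    simp

theorem laplacian_eq_trace_fderiv_gradient {f : E3 → ℝ} {x : E3} (hf : ContDiffAt ℝ 2 f x) :
    Laplacian.laplacian f x = traceCLM (fderiv ℝ (gradient f) x) := by
  have hd : DifferentiableAt ℝ (fderiv ℝ f) x :=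
    (hf.fderiv_right (m := 1) (by norm_num)).differentiableAt one_ne_zero
  have hg : fderiv ℝ (gradient f) x =
      ((InnerProductSpace.toDual ℝ E3).symm.toContinuousLinearEquiv.toContinuousLinearMap :
        (E3 →L[ℝ] ℝ) →L[ℝ] E3) ∘L fderiv ℝ (fderiv ℝ f) x :=
    (((InnerProductSpace.toDual ℝ E3).symm.toContinuousLinearEquiv.toContinuousLinearMap :
        (E3 →L[ℝ] ℝ) →L[ℝ] E3).hasFDerivAt.comp x hd.hasFDerivAt).fderiv
  rw [InnerProductSpace.laplacian_eq_iteratedFDeriv_orthonormalBasis f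
    (EuclideanSpace.basisFun (Fin 3) ℝ), traceCLM_apply, trace_eq_sum, hg]
  refine Finset.sum_congr rfl fun i _ => ?_
  have : ∀ v : E3, v i = inner ℝ v (e i) := fun v => by
    simp [e, EuclideanSpace.inner_single_right]
  rw [this]
  simp [iteratedFDeriv_two_apply, e]

end Calculus

/-! ### Jacobi's formula -/

section Jacobi

theorem det_eq_entries (L : E3 →L[ℝ] E3) :
    L.det = (Matrix.of fun i j : Fin 3 => L (e j) i).det := by
  rw [ContinuousLinearMap.det, ← LinearMap.det_toMatrix (EuclideanSpace.basisFun (Fin 3) ℝ).toBasis]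
  congr 1

/-- Jacobi's formula `(det F)' = det F · tr (F' F⁻¹)`, with `L` in the role of `F' F⁻¹`. -/
theorem hasDerivWithinAt_det {I : Set ℝ} {t : ℝ} {F : ℝ → E3 →L[ℝ] E3} {F' L : E3 →L[ℝ] E3}
    (hF : HasDerivWithinAt F F' I t) (hL : L ∘L F t = F') :
    HasDerivWithinAt (fun s => (F s).det) ((F t).det * traceCLM L) I t := by
  have hij : ∀ i j : Fin 3, HasDerivWithinAt (fun s => F s (e j) i) (F' (e j) i) I t := fun i j =>
    ((EuclideanSpace.proj i : E3 →L[ℝ] ℝ) ∘L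
      ContinuousLinearMap.apply ℝ E3 (e j)).hasFDerivAt.comp_hasDerivWithinAt t hF
  have hF' : ∀ i j : Fin 3, F' (e j) i = ∑ k : Fin 3, F t (e j) k * L (e k) i := fun i j => by
    rw [← hL, ContinuousLinearMap.comp_apply]
    conv_lhs => rw [eq_sum_smul_e (F t (e j))]
    simp [map_sum]
  simp only [det_eq_entries, Matrix.det_fin_three, Matrix.of_apply]
  refine ((((((((hij 0 0).mul (hij 1 1)).mul (hij 2 2)).sub
    (((hij 0 0).mul (hij 1 2)).mul (hij 2 1))).sub
    (((hij 0 1).mul (hij 1 0)).mul (hij 2 2))).add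
    (((hij 0 1).mul (hij 1 2)).mul (hij 2 0))).add
    (((hij 0 2).mul (hij 1 0)).mul (hij 2 1))).sub
    (((hij 0 2).mul (hij 1 1)).mul (hij 2 0))).congr_deriv ?_
  simp only [hF', traceCLM_apply, trace_eq_sum, Fin.sum_univ_three, Pi.mul_apply]
  ring

theorem isUnit_of_det_ne_zero {L : E3 →L[ℝ] E3} (h : L.det ≠ 0) : IsUnit L := by
  refine ⟨⟨L, (L.toContinuousLinearEquivOfDetNeZero h).symm, ?_, ?_⟩, rfl⟩
  · ext1 x
    exact (L.toContinuousLinearEquivOfDetNeZero h).apply_symm_apply x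
  · ext1 x
    exact (L.toContinuousLinearEquivOfDetNeZero h).symm_apply_apply x

/-- The derivative of `tr (V F⁻¹)` when `F' = V` and `V' = A F`; here `L = V F⁻¹`. -/
theorem hasDerivWithinAt_trace {I : Set ℝ} {t : ℝ} (ht : t ∈ I) {F V L : ℝ → E3 →L[ℝ] E3}
    {V' A : E3 →L[ℝ] E3} (hF : HasDerivWithinAt F (V t) I t) (hV : HasDerivWithinAt V V' I t)
    (hu : ∀ s ∈ I, IsUnit (F s)) (hL : ∀ s ∈ I, L s ∘L F s = V s) (hA : A ∘L F t = V') :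
    HasDerivWithinAt (fun s => traceCLM (L s)) (traceCLM A - traceCLM (L t ∘L L t)) I t := by
  obtain ⟨u, hu'⟩ := hu t ht
  have hinv := hasFDerivAt_ringInverse (𝕜 := ℝ) u
  rw [hu'] at hinv
  have h1 : HasDerivWithinAt (fun s => Ring.inverse (F s)) _ I t :=
    hinv.comp_hasDerivWithinAt t hF
  have h2 := hV.mul h1
  have hLeq : ∀ s ∈ I, L s = V s * Ring.inverse (F s) := by
    intro s hs
    rw [← hL s hs, ← ContinuousLinearMap.mul_def, mul_assoc, Ring.mul_inverse_cancel _ (hu s hs),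
      mul_one]
  have h3 : HasDerivWithinAt L (A - L t * L t) I t := by
    refine (h2.congr_of_mem (fun s hs => hLeq s hs) ht).congr_deriv ?_
    have hui : Ring.inverse (F t) = ((u⁻¹ : (E3 →L[ℝ] E3)ˣ) : E3 →L[ℝ] E3) := by
      rw [← hu', Ring.inverse_unit]
    rw [hLeq t ht, ← hA, ← ContinuousLinearMap.mul_def, hui, ← hu']
    simp [ContinuousLinearMap.mulLeftRight_apply, mul_assoc, sub_eq_add_neg]
    exact mul_neg (α := E3 →L[ℝ] E3) _ _
  refine (traceCLM.hasFDerivAt.comp_hasDerivWithinAt t h3).congr_deriv ?_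
  rw [map_sub]
  rfl

end Jacobi

/-! ### Time derivatives of curves of maps -/

section Time

theorem TendstoInCk.hasDerivWithinAt {k : ℕ} {K : Set E3} {I : Set ℝ} {t : ℝ} {f : ℝ → E3 → E3}
    {g : E3 → E3}
    (h : TendstoInCk k K (fun s x => (s - t)⁻¹ • (f s x - f t x)) (𝓝[I \ {t}] t) g)
    {x : E3} (hx : x ∈ K) : HasDerivWithinAt (fun s => f s x) (g x) I t := by
  rw [hasDerivWithinAt_iff_tendsto_slope]
  have h0 := (h 0 (Nat.zero_le _)).tendsto_at hx
  have := ((ContinuousMultilinearMap.apply ℝ (fun _ : Fin 0 => E3) E3 0).continuous.tendsto _).comp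
    h0
  refine (this.congr fun s => ?_).trans_eq (by simp)
  simp [slope_def_module]

/-- For a curve differentiable in `C¹`, the time derivative of the spatial derivative is the spatial
derivative of the time derivative. -/
theorem TendstoInCk.hasDerivWithinAt_fderiv {k : ℕ} (hk : 1 ≤ k) {K : Set E3} {I : Set ℝ} {t : ℝ}
    (ht : t ∈ I) {f : ℝ → E3 → E3} {g : E3 → E3}
    (h : TendstoInCk k K (fun s x => (s - t)⁻¹ • (f s x - f t x)) (𝓝[I \ {t}] t) g)
    {x : E3} (hx : K ∈ 𝓝 x) (hf : ∀ s ∈ I, DifferentiableAt ℝ (f s) x) :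
    HasDerivWithinAt (fun s => fderiv ℝ (f s) x) (fderiv ℝ g x) I t := by
  rw [hasDerivWithinAt_iff_tendsto_slope]
  have hcurry : ∀ u : E3 → E3, continuousMultilinearCurryFin1 ℝ E3 E3
      (iteratedFDerivWithin ℝ 1 u K x) = fderiv ℝ u x := fun u => by
    ext1 v
    rw [continuousMultilinearCurryFin1_apply,
      iteratedFDerivWithin_one_apply (uniqueDiffWithinAt_of_mem_nhds hx),
      fderivWithin_of_mem_nhds hx]
    rfl
  have h1 := (h 1 hk).tendsto_at (mem_of_mem_nhds hx)
  have h2 := ((continuousMultilinearCurryFin1 ℝ E3 E3).continuous.tendsto _).comp h1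
  rw [hcurry] at h2
  refine h2.congr' ?_
  filter_upwards [self_mem_nhdsWithin] with s hs
  rw [Function.comp_apply, hcurry, slope_def_module, ← fderiv_fun_sub (hf s hs.1) (hf t ht)]
  exact fderiv_const_smul (R := ℝ) ((hf s hs.1).fun_sub (hf t ht)) _

end Time

/-! ### The inverse of an embedding and conjugated operators -/

section Inverse

variable {Ω : Set E3} {f : E3 → E3}

theorem closure_mem_nhds (hΩ : IsOpen Ω) {x : E3} (hx : x ∈ Ω) : closure Ω ∈ 𝓝 x :=
  mem_of_superset (hΩ.mem_nhds hx) subset_closure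

theorem defGrad_eq_fderiv (hΩ : IsOpen Ω) (f : E3 → E3) {x : E3} (hx : x ∈ Ω) :
    defGrad Ω f x = fderiv ℝ f x :=
  fderivWithin_of_mem_nhds (closure_mem_nhds hΩ hx)

theorem spatial_apply {β : Type*} (hf : IsEmbeddingOfBody Ω f) (u : E3 → β) {x : E3}
    (hx : x ∈ closure Ω) : spatial Ω f u (f x) = u x := by
  rw [spatial, hf.injOn.leftInvOn_invFunOn hx]

theorem IsEmbeddingOfBody.contDiffAt (hf : IsEmbeddingOfBody Ω f) (hΩ : IsOpen Ω) {x : E3}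
    (hx : x ∈ Ω) : ContDiffAt ℝ 1 f x :=
  hf.contDiffOn.contDiffAt (closure_mem_nhds hΩ hx)

theorem IsEmbeddingOfBody.isUnit_fderiv (hf : IsEmbeddingOfBody Ω f) (hΩ : IsOpen Ω) {x : E3}
    (hx : x ∈ Ω) : IsUnit (fderiv ℝ f x) := by
  rw [← defGrad_eq_fderiv hΩ f hx]
  exact isUnit_of_det_ne_zero (hf.det_pos x (subset_closure hx)).ne'

theorem IsEmbeddingOfBody.hasFDerivAt_equiv (hf : IsEmbeddingOfBody Ω f) (hΩ : IsOpen Ω) {x : E3}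
    (hx : x ∈ Ω) : ∃ f' : E3 ≃L[ℝ] E3, HasFDerivAt f (f' : E3 →L[ℝ] E3) x := by
  have hd : (fderiv ℝ f x).det ≠ 0 := by
    rw [← defGrad_eq_fderiv hΩ f hx]
    exact (hf.det_pos x (subset_closure hx)).ne'
  refine ⟨(fderiv ℝ f x).toContinuousLinearEquivOfDetNeZero hd, ?_⟩
  exact ((hf.contDiffAt hΩ hx).differentiableAt one_ne_zero).hasFDerivAt

theorem IsEmbeddingOfBody.isOpen_image (hf : IsEmbeddingOfBody Ω f) (hΩ : IsOpen Ω) :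
    IsOpen (f '' Ω) := by
  rw [isOpen_iff_mem_nhds]
  rintro _ ⟨x, hx, rfl⟩
  obtain ⟨f', hf'⟩ := hf.hasFDerivAt_equiv hΩ hx
  rw [← ((hf.contDiffAt hΩ hx).hasStrictFDerivAt' hf' one_ne_zero).map_nhds_eq_of_equiv]
  exact image_mem_map (hΩ.mem_nhds hx)

theorem IsEmbeddingOfBody.contDiffAt_invFunOn (hf : IsEmbeddingOfBody Ω f) (hΩ : IsOpen Ω) {x : E3}
    (hx : x ∈ Ω) {n : ℕ∞} (hn : n ≠ 0) (hfn : ContDiffAt ℝ n f x) :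
    ContDiffAt ℝ n (Function.invFunOn f (closure Ω)) (f x) := by
  obtain ⟨f', hf'⟩ := hf.hasFDerivAt_equiv hΩ hx
  have hn' : (n : WithTop ℕ∞) ≠ 0 := by exact_mod_cast hn
  have hinv := hfn.to_localInverse hf' hn'
  refine hinv.congr_of_eventuallyEq ?_
  have h1 : ∀ᶠ y in 𝓝 (f x), f (hfn.localInverse hf' hn' y) = y :=
    (hfn.hasStrictFDerivAt' hf' hn').eventually_right_inverse
  have h2 : Tendsto (hfn.localInverse hf' hn') (𝓝 (f x)) (𝓝 x) := by
    have := hinv.continuousAt.tendsto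
    rwa [hfn.localInverse_apply_image hf' hn'] at this
  filter_upwards [h1, h2.eventually (closure_mem_nhds hΩ hx)] with y hy1 hy2
  conv_lhs => rw [← hy1]
  exact hf.injOn.leftInvOn_invFunOn hy2

theorem IsEmbeddingOfBody.contDiffOn_spatial {G : Type*} [NormedAddCommGroup G] [NormedSpace ℝ G]
    (hf : IsEmbeddingOfBody Ω f) (hΩ : IsOpen Ω)
    {n : ℕ∞} (hn : n ≠ 0) (hfn : ContDiffOn ℝ n f Ω) {u : E3 → G} (hu : ContDiffOn ℝ n u Ω) :
    ContDiffOn ℝ n (spatial Ω f u) (f '' Ω) := by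
  rintro _ ⟨x, hx, rfl⟩
  refine ContDiffAt.contDiffWithinAt ?_
  have h1 := hf.contDiffAt_invFunOn hΩ hx hn (hfn.contDiffAt (hΩ.mem_nhds hx))
  refine ContDiffAt.comp (f x) ?_ h1
  rw [hf.injOn.leftInvOn_invFunOn (subset_closure hx)]
  exact hu.contDiffAt (hΩ.mem_nhds hx)

theorem IsEmbeddingOfBody.continuousOn_spatial {G : Type*} [TopologicalSpace G]
    (hf : IsEmbeddingOfBody Ω f) (hΩ : IsOpen Ω) {u : E3 → G} (hu : ContinuousOn u Ω) :
    ContinuousOn (spatial Ω f u) (f '' Ω) := by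
  rintro _ ⟨x, hx, rfl⟩
  refine ContinuousAt.continuousWithinAt ?_
  have h1 := (hf.contDiffAt_invFunOn hΩ hx one_ne_zero (hf.contDiffAt hΩ hx)).continuousAt
  refine ContinuousAt.comp ?_ h1
  rw [hf.injOn.leftInvOn_invFunOn (subset_closure hx)]
  exact hu.continuousAt (hΩ.mem_nhds hx)

/-- Chain rule: `D_η V = DV (Dη)⁻¹`. -/
theorem IsEmbeddingOfBody.DEta_comp_fderiv (hf : IsEmbeddingOfBody Ω f) (hΩ : IsOpen Ω) {V : E3 → E3}
    {x : E3} (hx : x ∈ Ω) (hV : DifferentiableAt ℝ V x) :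
    DEta Ω f V x ∘L fderiv ℝ f x = fderiv ℝ V x := by
  have hfd := (hf.contDiffAt hΩ hx).differentiableAt one_ne_zero
  have hi := (hf.contDiffAt_invFunOn hΩ hx one_ne_zero (hf.contDiffAt hΩ hx)).differentiableAt
    one_ne_zero
  have hs : DifferentiableAt ℝ (spatial Ω f V) (f x) := by
    refine DifferentiableAt.comp (f x) ?_ hi
    rwa [hf.injOn.leftInvOn_invFunOn (subset_closure hx)]
  have h1 : HasFDerivAt (spatial Ω f V ∘ f) (DEta Ω f V x ∘L fderiv ℝ f x) x :=
    hs.hasFDerivAt.comp x hfd.hasFDerivAt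
  have h2 : spatial Ω f V ∘ f =ᶠ[𝓝 x] V := by
    filter_upwards [closure_mem_nhds hΩ hx] with y hy using spatial_apply hf V hy
  rw [← h1.fderiv, h2.fderiv_eq]

end Inverse

/-! ### Normals and tangent planes at the boundary -/

section Boundary

variable {Ω : Set E3} {f : E3 → E3}

theorem IsEmbeddingOfBody.map_mem_frontier (hf : IsEmbeddingOfBody Ω f) (hΩ : IsOpen Ω) {x : E3}
    (hx : x ∈ frontier Ω) : f x ∈ frontier (f '' Ω) := by
  rw [(hf.isOpen_image hΩ).frontier_eq]
  rw [hΩ.frontier_eq] at hx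
  refine ⟨?_, ?_⟩
  · exact ((hf.contDiffOn.continuousOn x hx.1).mono subset_closure).mem_closure_image hx.1
  · rintro ⟨z, hz, hzx⟩
    rw [hf.injOn (subset_closure hz) hx.1 hzx] at hz
    exact hx.2 hz

/-- A direction that points strictly into `Ω` is mapped by `Dη` to a direction that does not point
out of `η(Ω)`. -/
theorem inner_normal_defGrad_nonpos (hf : IsEmbeddingOfBody Ω f) {x n m v : E3}
    (hx : x ∈ closure Ω) (hn : IsOutwardUnitNormal Ω x n)
    (hm : IsOutwardUnitNormal (f '' Ω) (f x) m) (hv : inner ℝ n v < 0) :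
    inner ℝ m (defGrad Ω f x v) ≤ 0 := by
  obtain ⟨-, φ, hφ, hφ0, ⟨c, hc, hφn⟩, hφΩ⟩ := hn
  obtain ⟨-, χ, hχ, hχ0, ⟨d, hd, hχm⟩, hχΩ⟩ := hm
  have hγ : HasDerivAt (fun s : ℝ => x + s • v) v 0 := by
    simpa using ((hasDerivAt_id (0 : ℝ)).smul_const v).const_add x
  have hγ0 : x + (0 : ℝ) • v = x := by simp
  have hγt : Tendsto (fun s : ℝ => x + s • v) (𝓝[>] 0) (𝓝 x) := by
    have := hγ.continuousAt.tendsto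
    rw [hγ0] at this
    exact this.mono_left nhdsWithin_le_nhds
  -- the ray enters `Ω`
  have h1 : HasDerivAt (fun s : ℝ => φ (x + s • v)) (c * inner ℝ n v) 0 := by
    have hφd := (hφ.differentiableAt one_ne_zero).hasFDerivAt
    rw [← hγ0] at hφd
    refine (hφd.comp_hasDerivAt (0 : ℝ) hγ).congr_deriv ?_
    rw [hγ0, ← inner_gradient_left, hφn, inner_smul_left]
    rfl
  have h2 : ∀ᶠ s in 𝓝[>] (0 : ℝ), x + s • v ∈ Ω := by
    have ht := (hasDerivWithinAt_iff_tendsto_slope' (s := Ioi (0 : ℝ)) (by simp)).1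
      h1.hasDerivWithinAt
    filter_upwards [ht.eventually (gt_mem_nhds (mul_neg_of_pos_of_neg hc hv)), hγt.eventually hφΩ,
      self_mem_nhdsWithin] with s hs1 hs2 hs3
    rw [hs2]
    have hs3' : 0 < s := hs3
    rw [slope_def_field, hγ0, hφ0, sub_zero, sub_zero] at hs1
    exact (div_neg_iff.1 hs1).resolve_left (fun h => absurd h.2 hs3'.not_gt) |>.1
  have h3 : HasDerivWithinAt (fun s : ℝ => χ (f (x + s • v)))
      (d * inner ℝ m (defGrad Ω f x v)) (Ioi 0) 0 := by
    have hχd := (hχ.differentiableAt one_ne_zero).hasFDerivAt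
    have hfd : HasFDerivWithinAt f (defGrad Ω f x) (closure Ω) x :=
      (hf.contDiffOn.differentiableOn one_ne_zero x hx).hasFDerivWithinAt
    have hcomp : HasFDerivWithinAt (χ ∘ f) (fderiv ℝ χ (f x) ∘L defGrad Ω f x) (closure Ω) x :=
      hχd.comp_hasFDerivWithinAt x hfd
    rw [← hγ0] at hcomp
    have := hcomp.comp_hasDerivWithinAt (0 : ℝ)
      (hγ.hasDerivWithinAt (s := (fun s : ℝ => x + s • v) ⁻¹' closure Ω)) (mapsTo_preimage _ _)
    refine (this.mono_of_mem_nhdsWithin ?_).congr_deriv ?_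
    · filter_upwards [h2] with s hs using subset_closure hs
    · rw [hγ0, ContinuousLinearMap.comp_apply, ← inner_gradient_left, hχm, inner_smul_left]
      rfl
  have h4 : ∀ᶠ s in 𝓝[>] (0 : ℝ), slope (fun s : ℝ => χ (f (x + s • v))) 0 s ≤ 0 := by
    have hft : Tendsto (fun s : ℝ => f (x + s • v)) (𝓝[>] 0) (𝓝 (f x)) :=
      (hf.contDiffOn.continuousOn x hx).tendsto.comp (tendsto_nhdsWithin_iff.2
        ⟨hγt, h2.mono fun s hs => subset_closure hs⟩)
    filter_upwards [h2, hft.eventually hχΩ, self_mem_nhdsWithin] with s hs1 hs2 hs3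
    have hs3' : 0 < s := hs3
    rw [slope_def_field, hγ0, hχ0, sub_zero, sub_zero]
    exact div_nonpos_of_nonpos_of_nonneg (hs2.1 (mem_image_of_mem f hs1)).le hs3'.le
  have h5 := le_of_tendsto ((hasDerivWithinAt_iff_tendsto_slope' (by simp)).1 h3) h4
  exact nonpos_of_mul_nonpos_right h5 hd

/-- `Dη` maps tangent vectors of `∂Ω` to tangent vectors of the boundary of `η(Ω)`. -/
theorem inner_normal_defGrad_eq_zero (hf : IsEmbeddingOfBody Ω f) {x n m T : E3}
    (hx : x ∈ closure Ω) (hn : IsOutwardUnitNormal Ω x n)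
    (hm : IsOutwardUnitNormal (f '' Ω) (f x) m) (hT : inner ℝ T n = 0) :
    inner ℝ m (defGrad Ω f x T) = 0 := by
  have key : ∀ T : E3, inner ℝ T n = 0 → inner ℝ m (defGrad Ω f x T) ≤ 0 := by
    intro T hT
    have hlim : Tendsto (fun ε : ℝ => inner ℝ m (defGrad Ω f x T) -
        ε * inner ℝ m (defGrad Ω f x n)) (𝓝[>] 0) (𝓝 (inner ℝ m (defGrad Ω f x T))) := by
      have : Continuous fun ε : ℝ => inner ℝ m (defGrad Ω f x T) -
        ε * inner ℝ m (defGrad Ω f x n) := by fun_prop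
      simpa using (this.tendsto 0).mono_left nhdsWithin_le_nhds
    refine le_of_tendsto hlim ?_
    filter_upwards [self_mem_nhdsWithin] with ε hε
    have hε' : 0 < ε := hε
    -- tilting the tangent vector inwards makes it enter `Ω`
    have hv : inner ℝ n (T - ε • n) < 0 := by
      rw [inner_sub_right, inner_smul_right, real_inner_comm, hT, real_inner_self_eq_norm_sq, hn.1]
      simpa using hε'
    have := inner_normal_defGrad_nonpos hf hx hn hm hv
    rwa [map_sub, map_smul, inner_sub_right, inner_smul_right] at this
  have h1 := key T hT
  have h2 := key (-T) (by simp [hT])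
  rw [map_neg, inner_neg_right] at h2
  linarith

/-- `AᵀA` is positive definite on the plane orthogonal to `n`, as `A` is injective there. -/
theorem boundaryJacobian_pos {A : E3 →L[ℝ] E3} (hA : 0 < A.det) (n : E3) :
    0 < boundaryJacobian A n := by
  rw [boundaryJacobian]
  set B : ((ℝ ∙ n)ᗮ : Submodule ℝ E3) →L[ℝ] E3 :=
    A ∘L ((ℝ ∙ n)ᗮ : Submodule ℝ E3).subtypeL with hB
  have hAinj : Function.Injective A := (A.toContinuousLinearEquivOfDetNeZero hA.ne').injective
  have hBinj : Function.Injective B := hAinj.comp Subtype.val_injective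
  have hpos : (ContinuousLinearMap.adjoint B ∘L B).IsPositive :=
    ContinuousLinearMap.isPositive_adjoint_comp_self B
  have hpos' := (ContinuousLinearMap.isPositive_toLinearMap_iff _).2 hpos
  refine Real.sqrt_pos.2 (lt_of_le_of_ne ?_ (Ne.symm ?_))
  · rw [ContinuousLinearMap.det, hpos'.isSymmetric.det_eq_prod_eigenvalues rfl]
    exact Finset.prod_nonneg fun i _ => hpos'.nonneg_eigenvalues rfl i
  · intro h0
    have hker := LinearMap.bot_lt_ker_of_det_eq_zero h0
    obtain ⟨v, hv, hv0⟩ := Submodule.exists_mem_ne_zero_of_ne_bot hker.ne'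
    refine hv0 (hBinj ?_)
    rw [map_zero, ← inner_self_eq_zero (𝕜 := ℝ), ← ContinuousLinearMap.adjoint_inner_left]
    have : (ContinuousLinearMap.adjoint B) (B v) = 0 := hv
    rw [this, inner_zero_left]

/-- The image of the plane orthogonal to `n` under an invertible map is a plane, so a vector
orthogonal to it is a multiple of a given unit vector orthogonal to it. -/
theorem eq_inner_smul_of_perp {A : E3 →L[ℝ] E3} (hA : 0 < A.det) {n m s : E3} (hn : ‖n‖ = 1)
    (hm : ‖m‖ = 1) (hmT : ∀ T : E3, inner ℝ T n = 0 → inner ℝ m (A T) = 0)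
    (hsT : ∀ T : E3, inner ℝ T n = 0 → inner ℝ s (A T) = 0) : s = (inner ℝ s m : ℝ) • m := by
  have hdec : ∀ w : E3, ∃ T : E3, ∃ a : ℝ, inner ℝ T n = 0 ∧ w = A T + a • A n := by
    intro w
    obtain ⟨v, rfl⟩ := (A.toContinuousLinearEquivOfDetNeZero hA.ne').surjective w
    refine ⟨v - (inner ℝ v n : ℝ) • n, inner ℝ v n, ?_, ?_⟩
    · rw [inner_sub_left, inner_smul_left, real_inner_self_eq_norm_sq, hn]
      simp
    · simp
  -- `r` is orthogonal to the image plane and to `m`; as `m` is not in that plane, `r = 0`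
  set r := s - (inner ℝ s m : ℝ) • m with hr
  have hrT : ∀ T : E3, inner ℝ T n = 0 → inner ℝ r (A T) = 0 := fun T hT => by
    rw [hr, inner_sub_left, inner_smul_left, hmT T hT, hsT T hT]
    simp
  have hrm : inner ℝ r m = 0 := by
    rw [hr, inner_sub_left, inner_smul_left, real_inner_self_eq_norm_sq, hm]
    simp
  obtain ⟨T₀, a, hT₀, hma⟩ := hdec m
  obtain ⟨T₁, b, hT₁, hrb⟩ := hdec r
  have hmm : a * inner ℝ m (A n) = 1 := by
    have : (inner ℝ m m : ℝ) = 1 := by rw [real_inner_self_eq_norm_sq, hm]; norm_num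
    nth_rewrite 2 [hma] at this
    rwa [inner_add_right, inner_smul_right, hmT T₀ hT₀, zero_add] at this
  have hra : a * inner ℝ r (A n) = 0 := by
    have := hrm
    rw [hma, inner_add_right, inner_smul_right, hrT T₀ hT₀, zero_add] at this
    exact this
  have ha : a ≠ 0 := fun h => by simp [h] at hmm
  have hrn : inner ℝ r (A n) = 0 := (mul_eq_zero.1 hra).resolve_left ha
  have hrr : (inner ℝ r r : ℝ) = 0 := by
    nth_rewrite 2 [hrb]
    rw [inner_add_right, inner_smul_right, hrT T₁ hT₁, hrn]
    simp
  exact sub_eq_zero.1 (inner_self_eq_zero.1 hrr)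

end Boundary

/-! ### Regularity of the stress -/

section StressRegularity

theorem isOpen_posDet : IsOpen posDet :=
  isOpen_lt continuous_const ContinuousLinearMap.continuous_det

theorem contDiffOn_stress {n : ℕ} {W : (E3 →L[ℝ] E3) → ℝ}
    (hW : ContDiffOn ℝ (n + 1 : ℕ) W posDet) : ContDiffOn ℝ n (stress W) posDet := by
  have h1 : ContDiffOn ℝ n (fderiv ℝ W) posDet :=
    hW.fderiv_of_isOpen isOpen_posDet (by exact_mod_cast le_rfl)
  unfold stress
  exact ContDiffOn.sum fun a _ => ContDiffOn.sum fun i _ =>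
    (h1.clm_apply contDiffOn_const).smul contDiffOn_const

theorem contDiffOn_DivStress {n : ℕ} {W : (E3 →L[ℝ] E3) → ℝ}
    (hW : ContDiffOn ℝ (n + 2 : ℕ) W posDet) {Ω : Set E3} (hΩ : IsOpen Ω) {f : E3 → E3}
    (hf : IsEmbeddingOfBody Ω f) (hfn : ContDiffOn ℝ (n + 2 : ℕ) f Ω) :
    ContDiffOn ℝ n (DivStress W Ω f) Ω := by
  have h1 : ContDiffOn ℝ (n + 1 : ℕ) (defGrad Ω f) Ω :=
    (hfn.fderiv_of_isOpen hΩ (by exact_mod_cast le_rfl)).congr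
      fun x hx => defGrad_eq_fderiv hΩ f hx
  have h2 : ContDiffOn ℝ (n + 1 : ℕ) (fun y => stress W (defGrad Ω f y)) Ω :=
    (contDiffOn_stress hW).comp h1 fun x hx => hf.det_pos x (subset_closure hx)
  unfold DivStress
  refine ContDiffOn.sum fun i _ => ?_
  have h3 : ContDiffOn ℝ (n + 1 : ℕ) (fun y => stress W (defGrad Ω f y) (e i)) Ω :=
    h2.clm_apply contDiffOn_const
  exact (h3.fderiv_of_isOpen hΩ (by exact_mod_cast le_rfl)).clm_apply contDiffOn_const

end StressRegularity

/-! ### The pressure equation -/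

section Pressure

variable {Ω : Set E3} {f v : E3 → E3} {W : (E3 →L[ℝ] E3) → ℝ} {p q : E3 → ℝ} {ρ : ℝ}

theorem spatial_eventuallyEq (hΩ : IsOpen Ω) (hf : IsEmbeddingOfBody Ω f)
    (hpq : ∀ x ∈ closure Ω, q x = p (f x)) {y : E3} (hy : y ∈ f '' Ω) :
    spatial Ω f q =ᶠ[𝓝 y] p := by
  filter_upwards [(hf.isOpen_image hΩ).mem_nhds hy]
  rintro _ ⟨x, hx, rfl⟩
  rw [spatial_apply hf q (subset_closure hx), hpq x (subset_closure hx)]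

theorem gradEta_eq_gradient (hΩ : IsOpen Ω) (hf : IsEmbeddingOfBody Ω f)
    (hpq : ∀ x ∈ closure Ω, q x = p (f x)) {x : E3} (hx : x ∈ Ω) :
    gradEta Ω f q x = gradient p (f x) :=
  (spatial_eventuallyEq hΩ hf hpq (mem_image_of_mem f hx)).gradient_eq

theorem divEta_eq_traceCLM (V : E3 → E3) (x : E3) : divEta Ω f V x = traceCLM (DEta Ω f V x) :=
  (traceCLM_apply _).symm

theorem traceSq_eq_traceCLM (V : E3 → E3) (x : E3) :
    traceSq Ω f V x = traceCLM (DEta Ω f V x ∘L DEta Ω f V x) :=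
  (traceCLM_apply _).symm

theorem continuousOn_spatial_traceSq (hΩ : IsOpen Ω) (hf : IsEmbeddingOfBody Ω f)
    (hv : ContDiffOn ℝ 1 v Ω) : ContinuousOn (spatial Ω f (traceSq Ω f v)) (f '' Ω) := by
  have h1 : ContDiffOn ℝ 1 (spatial Ω f v) (f '' Ω) :=
    hf.contDiffOn_spatial hΩ one_ne_zero (hf.contDiffOn.mono subset_closure) hv
  have h2 := h1.continuousOn_fderiv_of_isOpen (hf.isOpen_image hΩ) le_rfl
  refine (traceCLM.continuous.comp_continuousOn (h2.clm_comp h2)).congr ?_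
  rintro _ ⟨x, hx, rfl⟩
  rw [spatial_apply hf _ (subset_closure hx), traceSq_eq_traceCLM]
  rfl

/-- If the field `∇p + (Div W'(Dη)) ∘ η⁻¹` on the deformed body is of class `C¹`, although its two
terms need not be, the distributional pressure equation says that its divergence is
`ρ trace (D_η v)²` at each point. -/
theorem pressureEqWeak_iff_trace_fderiv (hΩ : IsOpen Ω) (hf : IsEmbeddingOfBody Ω f)
    (hf2 : ContDiffOn ℝ 2 f Ω) (hW : ContDiffOn ℝ 2 W posDet) (hv : ContDiffOn ℝ 1 v Ω)
    {U : E3 → E3} (hU : ContDiffOn ℝ 1 U (f '' Ω))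
    (hUeq : ∀ y ∈ f '' Ω, gradient (spatial Ω f q) y + spatial Ω f (DivStress W Ω f) y = U y) :
    PressureEqWeak Ω ρ W f v q ↔
      ∀ x ∈ Ω, traceCLM (fderiv ℝ U (f x)) = ρ * traceSq Ω f v x := by
  have hO := hf.isOpen_image hΩ
  have hS : ContinuousOn (spatial Ω f (DivStress W Ω f)) (f '' Ω) :=
    hf.continuousOn_spatial hΩ (contDiffOn_DivStress (n := 0) hW hΩ hf hf2).continuousOn
  have hT := continuousOn_spatial_traceSq hΩ hf hv
  -- continuity is what is needed to split the integrals below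
  have hG : ContinuousOn (gradient (spatial Ω f q)) (f '' Ω) :=
    (hU.continuousOn.sub hS).congr fun y hy => eq_sub_of_add_eq (hUeq y hy)
  have hdU : ContinuousOn (fun y => traceCLM (fderiv ℝ U y)) (f '' Ω) :=
    traceCLM.continuous.comp_continuousOn (hU.continuousOn_fderiv_of_isOpen hO le_rfl)
  have hρT : ContinuousOn (fun y => ρ * spatial Ω f (traceSq Ω f v) y) (f '' Ω) :=
    continuousOn_const.mul hT
  have hiff := forall_integral_mul_eq_zero_iff hO (hdU.sub hρT)
  have hpt : (∀ y ∈ f '' Ω, ((fun y => traceCLM (fderiv ℝ U y)) -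
      fun y => ρ * spatial Ω f (traceSq Ω f v) y) y = 0) ↔
      ∀ x ∈ Ω, traceCLM (fderiv ℝ U (f x)) = ρ * traceSq Ω f v x := by
    rw [forall_mem_image]
    refine forall₂_congr fun x hx => ?_
    rw [Pi.sub_apply, sub_eq_zero, spatial_apply hf _ (subset_closure hx)]
  rw [← hpt, ← hiff]
  refine forall_congr' fun ψ => forall_congr' fun hψ => forall_congr' fun hc =>
    forall_congr' fun hs => ?_
  have i1 : ∫ y in f '' Ω, inner ℝ (U y) (gradient ψ y) =
      (∫ y in f '' Ω, inner ℝ (gradient (spatial Ω f q) y) (gradient ψ y)) +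
        ∫ y in f '' Ω, inner ℝ (spatial Ω f (DivStress W Ω f) y) (gradient ψ y) := by
    rw [← integral_add (integrable_inner_gradient hO hG hψ hc hs).integrableOn
      (integrable_inner_gradient hO hS hψ hc hs).integrableOn]
    refine setIntegral_congr_fun hO.measurableSet fun y hy => ?_
    simp only [← hUeq y hy, inner_add_left]
  have i2 : ∫ y in f '' Ω, ((fun y => traceCLM (fderiv ℝ U y)) -
      fun y => ρ * spatial Ω f (traceSq Ω f v) y) y * ψ y =
      (∫ y in f '' Ω, traceCLM (fderiv ℝ U y) * ψ y) -
        ρ * ∫ y in f '' Ω, spatial Ω f (traceSq Ω f v) y * ψ y := by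
    rw [← integral_const_mul, ← integral_sub
      (integrable_mul_of_tsupport_subset hO hdU hψ hc hs).integrableOn
      ((integrable_mul_of_tsupport_subset hO hT hψ hc hs).const_mul ρ).integrableOn]
    refine integral_congr_ae (Eventually.of_forall fun y => ?_)
    simp only [Pi.sub_apply]
    ring
  have i3 := integral_inner_gradient hO hU hψ hc hs
  rw [i2]
  constructor <;> intro h <;> linarith

/-- Along a solution of the momentum equation the pressure equation is the statement that the
time derivative of `div_η η̇` vanishes. -/
theorem pressureEqWeak_iff_divEta (hΩ : IsOpen Ω) (hf : IsEmbeddingOfBody Ω f)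
    (hf2 : ContDiffOn ℝ 2 f Ω) (hW : ContDiffOn ℝ 2 W posDet) (hρ : 0 < ρ)
    (hv : ContDiffOn ℝ 1 v Ω) {a : E3 → E3} (ha : ContDiffOn ℝ 1 a Ω)
    (hpq : ∀ x ∈ closure Ω, q x = p (f x))
    (hmom : ∀ x ∈ Ω, ρ • a x - DivStress W Ω f x = gradient p (f x)) :
    PressureEqWeak Ω ρ W f v q ↔ ∀ x ∈ Ω, divEta Ω f a x = traceSq Ω f v x := by
  have ha' : ContDiffOn ℝ 1 (spatial Ω f a) (f '' Ω) :=
    hf.contDiffOn_spatial hΩ one_ne_zero (hf.contDiffOn.mono subset_closure) ha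
  rw [pressureEqWeak_iff_trace_fderiv hΩ hf hf2 hW hv (U := fun y => ρ • spatial Ω f a y)
    (ha'.const_smul ρ)]
  · refine forall₂_congr fun x hx => ?_
    have hd : DifferentiableAt ℝ (spatial Ω f a) (f x) :=
      (ha'.contDiffAt ((hf.isOpen_image hΩ).mem_nhds (mem_image_of_mem f hx))).differentiableAt
        one_ne_zero
    rw [fderiv_fun_const_smul hd, map_smul, smul_eq_mul, mul_right_inj' hρ.ne',
      divEta_eq_traceCLM]
    rfl
  · rintro _ ⟨x, hx, rfl⟩
    rw [(spatial_eventuallyEq hΩ hf hpq (mem_image_of_mem f hx)).gradient_eq, ← hmom x hx,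
      spatial_apply hf _ (subset_closure hx), spatial_apply hf _ (subset_closure hx), sub_add_cancel]

theorem pressureEqWeak_iff_pointwise (hΩ : IsOpen Ω) (hf : IsEmbeddingOfBody Ω f)
    (hf3 : ContDiffOn ℝ 3 f Ω) (hW : ContDiffOn ℝ 3 W posDet) (hv : ContDiffOn ℝ 1 v Ω)
    (hpq : ∀ x ∈ closure Ω, q x = p (f x)) (hp : ContDiffOn ℝ 2 p (f '' Ω)) :
    PressureEqWeak Ω ρ W f v q ↔ PressureEqPointwise Ω ρ W f v q := by
  have hO := hf.isOpen_image hΩ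
  have hS : ContDiffOn ℝ 1 (spatial Ω f (DivStress W Ω f)) (f '' Ω) :=
    hf.contDiffOn_spatial hΩ one_ne_zero (hf.contDiffOn.mono subset_closure)
      (contDiffOn_DivStress (n := 1) hW hΩ hf hf3)
  have hG : ∀ y ∈ f '' Ω, ContDiffAt ℝ 1 (gradient p) y := fun y hy =>
    contDiffAt_gradient_iff.2 ((hp.contDiffAt (hO.mem_nhds hy)).fderiv_right (by norm_num))
  rw [pressureEqWeak_iff_trace_fderiv hΩ hf (hf3.of_le (by norm_num)) (hW.of_le (by norm_num)) hv
    (U := fun y => gradient p y + spatial Ω f (DivStress W Ω f) y)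
    (ContDiffOn.add (fun y hy => (hG y hy).contDiffWithinAt) hS)]
  · refine forall₂_congr fun x hx => ?_
    have hx' := mem_image_of_mem f hx
    have hSd : DifferentiableAt ℝ (spatial Ω f (DivStress W Ω f)) (f x) :=
      (hS.contDiffAt (hO.mem_nhds hx')).differentiableAt one_ne_zero
    have hlap : lapEta Ω f q x = traceCLM (fderiv ℝ (gradient p) (f x)) := by
      rw [lapEta, (InnerProductSpace.laplacian_congr_nhds
        (spatial_eventuallyEq hΩ hf hpq hx')).eq_of_nhds]
      exact laplacian_eq_trace_fderiv_gradient (hp.contDiffAt (hO.mem_nhds hx'))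
    rw [fderiv_fun_add ((hG _ hx').differentiableAt one_ne_zero) hSd, map_add, hlap,
      divEta_eq_traceCLM, DEta]
    constructor <;> intro h <;> linarith
  · intro y hy
    rw [(spatial_eventuallyEq hΩ hf hpq hy).gradient_eq]

theorem contDiffOn_pressure (hΩ : IsOpen Ω) (hf : IsEmbeddingOfBody Ω f)
    (hf3 : ContDiffOn ℝ 3 f Ω) (hW : ContDiffOn ℝ 3 W posDet) {a : E3 → E3}
    (ha : ContDiffOn ℝ 1 a Ω) (hp : ContDiffOn ℝ 1 p (f '' Ω))
    (hmom : ∀ x ∈ Ω, ρ • a x - DivStress W Ω f x = gradient p (f x)) :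
    ContDiffOn ℝ 2 p (f '' Ω) := by
  have hO := hf.isOpen_image hΩ
  have hf1 : ContDiffOn ℝ 1 f Ω := hf.contDiffOn.mono subset_closure
  have hS : ContDiffOn ℝ 1 (spatial Ω f (DivStress W Ω f)) (f '' Ω) :=
    hf.contDiffOn_spatial hΩ one_ne_zero hf1 (contDiffOn_DivStress (n := 1) hW hΩ hf hf3)
  have ha' : ContDiffOn ℝ 1 (spatial Ω f a) (f '' Ω) :=
    hf.contDiffOn_spatial hΩ one_ne_zero hf1 ha
  have hG : ContDiffOn ℝ 1 (gradient p) (f '' Ω) := by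
    refine ((ha'.const_smul ρ).sub hS).congr ?_
    rintro _ ⟨x, hx, rfl⟩
    rw [spatial_apply hf _ (subset_closure hx), spatial_apply hf _ (subset_closure hx), hmom x hx]
  have h2 : ContDiffOn ℝ (1 + 1) p (f '' Ω) := by
    refine (contDiffOn_succ_iff_fderiv_of_isOpen hO).2 ⟨hp.differentiableOn one_ne_zero, by simp,
      fun y hy => ?_⟩
    exact (contDiffAt_gradient_iff.1 (hG.contDiffAt (hO.mem_nhds hy))).contDiffWithinAt
  rwa [one_add_one_eq_two] at h2

end Pressure

/-! ### The traction condition -/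

section BoundaryConditions

variable {Ω : Set E3} {f : E3 → E3} {W : (E3 →L[ℝ] E3) → ℝ} {p q : E3 → ℝ} {N ν : E3 → E3}

/-- The vectorial traction condition splits into its tangential part, the orthogonality of `W'(Dη)N`
to the images of tangent vectors, and its normal part, the Dirichlet condition for `q`. -/
theorem traction_iff (hΩ : IsOpen Ω) (hf : IsEmbeddingOfBody Ω f)
    (hN : ∀ x ∈ frontier Ω, IsOutwardUnitNormal Ω x (N x))
    (hν : ∀ y ∈ frontier (f '' Ω), IsOutwardUnitNormal (f '' Ω) y (ν y))
    (hpq : ∀ x ∈ closure Ω, q x = p (f x)) :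
    (∀ x ∈ frontier Ω, stress W (defGrad Ω f x) (N x) +
      (p (f x) * boundaryJacobian (defGrad Ω f x) (N x)) • ν (f x) = 0) ↔
    StressNormalPerp Ω W N f ∧ PressureBoundaryCondition Ω W N ν f q := by
  unfold StressNormalPerp PressureBoundaryCondition
  rw [← forall₂_and]
  refine forall₂_congr fun x hx => ?_
  have hxc : x ∈ closure Ω := frontier_subset_closure hx
  have hm := hν _ (hf.map_mem_frontier hΩ hx)
  have hJ := boundaryJacobian_pos (hf.det_pos x hxc) (N x)
  have hmT : ∀ T : E3, inner ℝ T (N x) = 0 → inner ℝ (ν (f x)) (defGrad Ω f x T) = 0 :=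
    fun T hT => inner_normal_defGrad_eq_zero hf hxc (hN x hx) hm hT
  rw [hpq x hxc]
  constructor
  · intro h
    have hs := eq_neg_of_add_eq_zero_left h
    refine ⟨fun T hT => ?_, ?_⟩
    · rw [hs, inner_neg_left, inner_smul_left, hmT T hT, mul_zero, neg_zero]
    · rw [eq_div_iff hJ.ne', hs, inner_neg_left, inner_smul_left, real_inner_self_eq_norm_sq, hm.1]
      simp
  · rintro ⟨h1, h2⟩
    have hs := eq_inner_smul_of_perp (hf.det_pos x hxc) (hN x hx).1 hm.1 hmT h1
    rw [h2, div_mul_cancel₀ _ hJ.ne', neg_smul, ← hs, add_neg_cancel]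

end BoundaryConditions

/-! ### Kinematics of a motion -/

section Motion

variable {Ω : Set E3} {I : Set ℝ} {η : ℝ → E3 → E3}

theorem uniqueDiffOn_of_ordConnected (hI : I.OrdConnected) (hI' : I.Nontrivial) :
    UniqueDiffOn ℝ I :=
  uniqueDiffOn_convex hI.convex (hI.convex.nontrivial_iff_nonempty_interior.1 hI')

theorem eq_of_hasDerivWithinAt_zero (hI : I.OrdConnected) (hI' : I.Nontrivial) {g : ℝ → ℝ}
    (hg : ∀ t ∈ I, HasDerivWithinAt g 0 I t) {s t : ℝ} (hs : s ∈ I) (ht : t ∈ I) : g s = g t := by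
  refine hI.convex.is_const_of_fderivWithin_eq_zero (𝕜 := ℝ)
    (fun r hr => (hg r hr).differentiableWithinAt) (fun r hr => ?_) hs ht
  rw [(hg r hr).hasFDerivWithinAt.fderivWithin (uniqueDiffOn_of_ordConnected hI hI' r hr)]
  ext
  simp

theorem differentiableAt_of_contDiffOn_closure (hΩ : IsOpen Ω) {u : E3 → E3}
    (hu : ContDiffOn ℝ 2 u (closure Ω)) {x : E3} (hx : x ∈ Ω) : DifferentiableAt ℝ u x :=
  (hu.contDiffAt (closure_mem_nhds hΩ hx)).differentiableAt two_ne_zero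

theorem hasDerivWithinAt_det_defGrad (hΩ : IsOpen Ω) (hη : IsC2CurveInCk 2 I (closure Ω) η)
    (hηe : ∀ t ∈ I, IsEmbeddingOfBody Ω (η t)) {t : ℝ} (ht : t ∈ I) {x : E3} (hx : x ∈ Ω) :
    HasDerivWithinAt (fun s => (defGrad Ω (η s) x).det)
      ((defGrad Ω (η t) x).det * divEta Ω (η t) (velocity I η t) x) I t := by
  simp only [defGrad_eq_fderiv hΩ _ hx, divEta_eq_traceCLM]
  exact hasDerivWithinAt_det
    ((hη.hasDeriv_position t ht).hasDerivWithinAt_fderiv one_le_two ht (closure_mem_nhds hΩ hx)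
      fun s hs => differentiableAt_of_contDiffOn_closure hΩ (hη.position_mem s hs) hx)
    ((hηe t ht).DEta_comp_fderiv hΩ hx
      (differentiableAt_of_contDiffOn_closure hΩ (hη.velocity_mem t ht) hx))

theorem hasDerivWithinAt_divEta_velocity (hΩ : IsOpen Ω) (hη : IsC2CurveInCk 2 I (closure Ω) η)
    (hηe : ∀ t ∈ I, IsEmbeddingOfBody Ω (η t)) {t : ℝ} (ht : t ∈ I) {x : E3} (hx : x ∈ Ω) :
    HasDerivWithinAt (fun s => divEta Ω (η s) (velocity I η s) x)
      (divEta Ω (η t) (acceleration I η t) x - traceSq Ω (η t) (velocity I η t) x) I t := by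
  simp only [divEta_eq_traceCLM, traceSq_eq_traceCLM]
  have hvd : ∀ s ∈ I, DifferentiableAt ℝ (velocity I η s) x := fun s hs =>
    differentiableAt_of_contDiffOn_closure hΩ (hη.velocity_mem s hs) hx
  exact hasDerivWithinAt_trace ht
    (F := fun s => fderiv ℝ (η s) x) (V := fun s => fderiv ℝ (velocity I η s) x)
    ((hη.hasDeriv_position t ht).hasDerivWithinAt_fderiv one_le_two ht (closure_mem_nhds hΩ hx)
      fun s hs => differentiableAt_of_contDiffOn_closure hΩ (hη.position_mem s hs) hx)
    ((hη.hasDeriv_velocity t ht).hasDerivWithinAt_fderiv one_le_two ht (closure_mem_nhds hΩ hx) hvd)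
    (fun s hs => (hηe s hs).isUnit_fderiv hΩ hx)
    (fun s hs => (hηe s hs).DEta_comp_fderiv hΩ hx (hvd s hs))
    ((hηe t ht).DEta_comp_fderiv hΩ hx
      (differentiableAt_of_contDiffOn_closure hΩ (hη.acceleration_mem t ht) hx))

/-- If `det Dη` is constant in time, then `div_η η̇ = 0`. -/
theorem divEta_velocity_eq_zero (hΩ : IsOpen Ω) (hI : I.OrdConnected) (hI' : I.Nontrivial)
    (hη : IsC2CurveInCk 2 I (closure Ω) η) (hηe : ∀ t ∈ I, IsEmbeddingOfBody Ω (η t)) {x : E3}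
    (hx : x ∈ Ω) (hdet : ∀ t ∈ I, (defGrad Ω (η t) x).det = 1) {t : ℝ} (ht : t ∈ I) :
    divEta Ω (η t) (velocity I η t) x = 0 := by
  have h1 := hasDerivWithinAt_det_defGrad hΩ hη hηe ht hx
  have h2 : HasDerivWithinAt (fun s => (defGrad Ω (η s) x).det) 0 I t :=
    (hasDerivWithinAt_const t I (1 : ℝ)).congr_of_mem (fun s hs => hdet s hs) ht
  have h3 := (uniqueDiffOn_of_ordConnected hI hI' t ht).eq_deriv _ h1 h2
  rwa [hdet t ht, one_mul] at h3

theorem divEta_acceleration_eq_traceSq (hΩ : IsOpen Ω) (hI : I.OrdConnected) (hI' : I.Nontrivial)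
    (hη : IsC2CurveInCk 2 I (closure Ω) η) (hηe : ∀ t ∈ I, IsEmbeddingOfBody Ω (η t)) {x : E3}
    (hx : x ∈ Ω) (hdiv : ∀ t ∈ I, divEta Ω (η t) (velocity I η t) x = 0) {t : ℝ} (ht : t ∈ I) :
    divEta Ω (η t) (acceleration I η t) x = traceSq Ω (η t) (velocity I η t) x := by
  have h1 := hasDerivWithinAt_divEta_velocity hΩ hη hηe ht hx
  have h2 : HasDerivWithinAt (fun s => divEta Ω (η s) (velocity I η s) x) 0 I t :=
    (hasDerivWithinAt_const t I (0 : ℝ)).congr_of_mem (fun s hs => hdiv s hs) ht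
  exact sub_eq_zero.1 ((uniqueDiffOn_of_ordConnected hI hI' t ht).eq_deriv _ h1 h2)

/-- The pressure equation propagates the two incompressibility constraints: first `div_η η̇`, then
`det Dη` has vanishing time derivative. -/
theorem det_defGrad_eq_one (hΩ : IsOpen Ω) (hI : I.OrdConnected) (hI' : I.Nontrivial)
    (hη : IsC2CurveInCk 2 I (closure Ω) η) (hηe : ∀ t ∈ I, IsEmbeddingOfBody Ω (η t)) {x : E3}
    (hx : x ∈ Ω)
    (hacc : ∀ t ∈ I, divEta Ω (η t) (acceleration I η t) x = traceSq Ω (η t) (velocity I η t) x)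
    {t₀ : ℝ} (ht₀ : t₀ ∈ I) (hdet : (defGrad Ω (η t₀) x).det = 1)
    (hdiv : divEta Ω (η t₀) (velocity I η t₀) x = 0) {t : ℝ} (ht : t ∈ I) :
    (defGrad Ω (η t) x).det = 1 := by
  have hdiv' : ∀ s ∈ I, divEta Ω (η s) (velocity I η s) x = 0 := fun s hs => by
    rw [← hdiv]
    refine eq_of_hasDerivWithinAt_zero hI hI'
      (g := fun s => divEta Ω (η s) (velocity I η s) x) (fun r hr => ?_) hs ht₀
    exact (hasDerivWithinAt_divEta_velocity hΩ hη hηe hr hx).congr_deriv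
      (sub_eq_zero.2 (hacc r hr))
  rw [← hdet]
  refine eq_of_hasDerivWithinAt_zero hI hI' (g := fun s => (defGrad Ω (η s) x).det)
    (fun r hr => ?_) ht ht₀
  exact (hasDerivWithinAt_det_defGrad hΩ hη hηe hr hx).congr_deriv (by rw [hdiv' r hr, mul_zero])

/-- The first-order system is the momentum equation written for `(η, ρ η̇)`. -/
theorem firstOrderSystem_iff_momentum {ρ : ℝ} {W : (E3 →L[ℝ] E3) → ℝ} {p q : ℝ → E3 → ℝ}
    (hΩ : IsOpen Ω) (hI : I.OrdConnected) (hI' : I.Nontrivial)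
    (hη : IsC2CurveInCk 2 I (closure Ω) η) (hηe : ∀ t ∈ I, IsEmbeddingOfBody Ω (η t))
    (hpq : ∀ t ∈ I, ∀ x ∈ closure Ω, q t x = p t (η t x)) :
    FirstOrderSystem Ω ρ W I η q ↔ ∀ t ∈ I, ∀ x ∈ Ω,
      ρ • acceleration I η t x - DivStress W Ω (η t) x = gradient (p t) (η t x) := by
  refine forall₂_congr fun t ht => forall₂_congr fun x hx => ?_
  have hv := (hη.hasDeriv_position t ht).hasDerivWithinAt (subset_closure hx)
  have ha := ((hη.hasDeriv_velocity t ht).hasDerivWithinAt (subset_closure hx)).const_smul ρ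
  have hA : forceA W Ω (η t) (q t) x = DivStress W Ω (η t) x + gradient (p t) (η t x) := by
    rw [forceA, gradEta_eq_gradient hΩ (hηe t ht) (hpq t ht) hx]
  rw [hA, sub_eq_iff_eq_add']
  constructor
  · intro h
    have := (uniqueDiffOn_of_ordConnected hI hI' t ht).eq_deriv _ (hv.prodMk ha) h
    exact congrArg Prod.snd this
  · intro h
    rw [← h]
    exact hv.prodMk ha

end Motion

end ElasticBody

/-! ### The equivalence of the two systems -/

open ElasticBody in
theorem proposition1
    (α : ℝ≥0) (hα : 0 < α) (hα1 : α ≤ 1)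
    (Ω : Set E3) (hΩo : IsOpen Ω) (hΩc : IsConnected Ω) (hΩb : Bornology.IsBounded Ω)
    (hΩ : HasC1HolderBoundary α Ω)
    (ρ : ℝ) (hρ : 0 < ρ)
    (W : (E3 →L[ℝ] E3) → ℝ) (hW : ContDiffOn ℝ 2 W posDet)
    (I : Set ℝ) (hI : I.OrdConnected) (hI' : I.Nontrivial)
    (η : ℝ → E3 → E3) (hη : IsC2CurveInCk 2 I (closure Ω) η)
    (hηe : ∀ t ∈ I, IsEmbeddingOfBody Ω (η t))
    (N : E3 → E3) (hN : ∀ x ∈ frontier Ω, IsOutwardUnitNormal Ω x (N x))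
    (ν : ℝ → E3 → E3)
    (hν : ∀ t ∈ I, ∀ y ∈ frontier (η t '' Ω), IsOutwardUnitNormal (η t '' Ω) y (ν t y))
    (p q : ℝ → E3 → ℝ)
    (hp : ∀ t ∈ I, ContDiffOn ℝ 1 (p t) (η t '' Ω) ∧ ContinuousOn (p t) (η t '' closure Ω))
    (hpq : ∀ t ∈ I, ∀ x ∈ closure Ω, q t x = p t (η t x)) :
    -- the equations of motion imply the first-order system with the pressure problem
    (EquationsOfMotion Ω ρ W I N ν η p →
      (∀ t ∈ I, ∀ x ∈ Ω, divEta Ω (η t) (velocity I η t) x = 0) ∧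
      (∀ t ∈ I, StressNormalPerp Ω W N (η t)) ∧
      FirstOrderSystem Ω ρ W I η q ∧
      (∀ t ∈ I, PressureEqWeak Ω ρ W (η t) (velocity I η t) (q t) ∧
        PressureBoundaryCondition Ω W N (ν t) (η t) (q t))) ∧
    -- conversely, with the incompressibility constraints imposed at one time only
    (∀ t₀ ∈ I, (∀ x ∈ Ω, (defGrad Ω (η t₀) x).det = 1) →
      (∀ x ∈ Ω, divEta Ω (η t₀) (velocity I η t₀) x = 0) →
      (∀ t ∈ I, StressNormalPerp Ω W N (η t)) →
      FirstOrderSystem Ω ρ W I η q →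
      (∀ t ∈ I, PressureEqWeak Ω ρ W (η t) (velocity I η t) (q t) ∧
        PressureBoundaryCondition Ω W N (ν t) (η t) (q t)) →
      EquationsOfMotion Ω ρ W I N ν η p) ∧
    -- for more regular motions the pressure equation is a pointwise one
    (ContDiffOn ℝ 3 W posDet → ∀ t ∈ I, ContDiffOn ℝ 3 (η t) Ω →
      (EquationsOfMotion Ω ρ W I N ν η p → ContDiffOn ℝ 2 (p t) (η t '' Ω)) ∧
      (ContDiffOn ℝ 2 (p t) (η t '' Ω) →
        (PressureEqWeak Ω ρ W (η t) (velocity I η t) (q t) ↔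
          PressureEqPointwise Ω ρ W (η t) (velocity I η t) (q t)))) := by
  have hf2 : ∀ t ∈ I, ContDiffOn ℝ 2 (η t) Ω := fun t ht =>
    (hη.position_mem t ht).mono subset_closure
  have hv1 : ∀ t ∈ I, ContDiffOn ℝ 1 (velocity I η t) Ω := fun t ht =>
    ((hη.velocity_mem t ht).mono subset_closure).of_le one_le_two
  have ha1 : ∀ t ∈ I, ContDiffOn ℝ 1 (acceleration I η t) Ω := fun t ht =>
    ((hη.acceleration_mem t ht).mono subset_closure).of_le one_le_two
  have hfos := firstOrderSystem_iff_momentum (ρ := ρ) (W := W) hΩo hI hI' hη hηe hpq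
  have htr := fun t (ht : t ∈ I) =>
    traction_iff (W := W) hΩo (hηe t ht) hN (hν t ht) (hpq t ht)
  have hweak := fun t (ht : t ∈ I) => pressureEqWeak_iff_divEta (p := p t) (q := q t) hΩo
    (hηe t ht) (hf2 t ht) hW hρ (hv1 t ht) (ha1 t ht) (hpq t ht)
  refine ⟨fun h => ?_, fun t₀ ht₀ hdet hdiv hperp hF hP => ?_, fun hW3 t ht hη3 => ⟨fun h => ?_,
    fun hp2 => ?_⟩⟩
  · have hdiv : ∀ t ∈ I, ∀ x ∈ Ω, divEta Ω (η t) (velocity I η t) x = 0 := fun t ht x hx =>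
      divEta_velocity_eq_zero hΩo hI hI' hη hηe hx (fun s hs => h.incompressible s hs x hx) ht
    refine ⟨hdiv, fun t ht => ((htr t ht).1 (h.traction t ht)).1, hfos.2 h.momentum,
      fun t ht => ⟨(hweak t ht (h.momentum t ht)).2 fun x hx => ?_,
        ((htr t ht).1 (h.traction t ht)).2⟩⟩
    exact divEta_acceleration_eq_traceSq hΩo hI hI' hη hηe hx (fun s hs => hdiv s hs x hx) ht
  · have hmom := hfos.1 hF
    refine ⟨fun t ht x hx => ?_, hmom, fun t ht => (htr t ht).2 ⟨hperp t ht, (hP t ht).2⟩⟩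
    exact det_defGrad_eq_one hΩo hI hI' hη hηe hx
      (fun s hs => (hweak s hs (hmom s hs)).1 (hP s hs).1 x hx) ht₀ (hdet x hx) (hdiv x hx) ht
  · exact contDiffOn_pressure hΩo (hηe t ht) hη3 hW3 (ha1 t ht) (hp t ht).1 (h.momentum t ht)
  · exact pressureEqWeak_iff_pointwise hΩo (hηe t ht) hη3 hW3 (hv1 t ht) (hpq t ht) hp2
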